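/- Let $n,t\ge 1$ be integers and let $(\mathbf S_\gamma)_{\gamma\in\mathbb N_0^n}$ be a family of real symmetric $t\times t$ matrices. A matrix-valued measure on $\mathbb R^n$ is a matrix $\mathbf E=(\sigma_{ij})_{i,j=1}^t$ of finite signed Borel measures on $\mathbb R^n$; its support is the union of the supports of the $\sigma_{ij}$ (the support of a signed measure being that of its total variation), it is positive semidefinite if $\sigma_{ij}=\sigma_{ji}$ for all $i,j$ and $v^T\mathbf E(A)v\ge 0$ for all Borel sets $A\subseteq\mathbb R^n$ and all $v\in\mathbb R^t$, and $\int f\,d\mathbf E:=(\int f\,d\sigma_{ij})_{i,j}$. The family $(\mathbf S_\gamma)$ is called a matrix-valued $[-1,1]^n$-moment sequence if there is a positive semidefinite matrix-valued measure $\mathbf E$ on $\mathbb R^n$ with support contained in $[-1,1]^n$ such that $\mathbf S_\gamma=\int x_1^{\gamma_1}\cdots x_n^{\gamma_n}\,d\mathbf E(x)$ for every $\gamma\in\mathbb N_0^n$ (all these integrals being absolutely convergent). For $\alpha,\beta\in\mathbb N_0^{2n}$ write $\beta\le\alpha$ if $\beta_k\le\alpha_k$ for all $k$, and put $\binom{\alpha}{\beta}=\prod_{k=1}^{2n}\binom{\alpha_k}{\beta_k}$,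 $e(\beta)=\sum_{i=1}^n\beta_{2i}$ and $\pi(\beta)=(\beta_1+\beta_2,\beta_3+\beta_4,\dots,\beta_{2n-1}+\beta_{2n})\in\mathbb N_0^n$. Then $(\mathbf S_\gamma)_{\gamma\in\mathbb N_0^n}$ is a matrix-valued $[-1,1]^n$-moment sequence if and only if $$\sum_{\beta\in\mathbb N_0^{2n},\ \beta\le\alpha}(-1)^{e(\beta)}\binom{\alpha}{\beta}\operatorname{tr}\bigl(\mathbf G\,\mathbf S_{\pi(\beta)}\bigr)\ \ge\ 0$$ for all (symmetric) positive definite matrices $\mathbf G\in M_t(\mathbb R)$ and all $\alpha\in\mathbb N_0^{2n}$. -/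

import Mathlib

open scoped Matrix

noncomputable section

/-- A `t × t` matrix-valued measure on `ℝⁿ`: a `t × t` array `(σ i j)` of finite signed Borel
measures on `ℝⁿ`. -/
abbrev MatrixMeasure (n t : ℕ) : Type :=
  Fin t → Fin t → MeasureTheory.SignedMeasure (Fin n → ℝ)

namespace MatrixMeasure

variable {n t : ℕ}

/-- The matrix `E(A) = (σ i j (A))`. -/
def value (E : MatrixMeasure n t) (A : Set (Fin n → ℝ)) : Matrix (Fin t) (Fin t) ℝ :=
  Matrix.of fun i j => E i j A

/-- `E` is positive semidefinite: `σ i j = σ j i` for all `i, j`, and `vᵀ E(A) v ≥ 0` for every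
Borel set `A` and every vector `v`. -/
def IsPosSemidef (E : MatrixMeasure n t) : Prop :=
  (∀ i j, E i j = E j i) ∧
    ∀ A : Set (Fin n → ℝ), MeasurableSet A → ∀ v : Fin t → ℝ, 0 ≤ v ⬝ᵥ (E.value A *ᵥ v)

/-- The support of `E`: the union of the (closed) supports of the entries, the support of a signed
measure being the support of its total variation. -/
def support (E : MatrixMeasure n t) : Set (Fin n → ℝ) :=
  ⋃ i, ⋃ j, (E i j).variation.support

/-- `f` is integrable with respect to every entry of `E`. -/
def Integrable (E : MatrixMeasure n t) (f : (Fin n → ℝ) → ℝ) : Prop :=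
  ∀ i j, (E i j).Integrable f

/-- The matrix-valued integral `∫ f dE = (∫ f dσ i j)`. -/
def integral (E : MatrixMeasure n t) (f : (Fin n → ℝ) → ℝ) : Matrix (Fin t) (Fin t) ℝ :=
  Matrix.of fun i j => ∫ᵛ x, f x ∂<•(E i j)

end MatrixMeasure

/-- `S` is a matrix-valued `K`-moment sequence: there is a positive semidefinite matrix-valued
measure `E` on `ℝⁿ` with support in `K` such that `S α = ∫ x ^ α dE(x)` for every multi-index `α`
(the integrals being convergent). -/
def IsMatrixMomentSequence {n t : ℕ} (K : Set (Fin n → ℝ))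
    (S : (Fin n → ℕ) → Matrix (Fin t) (Fin t) ℝ) : Prop :=
  ∃ E : MatrixMeasure n t, E.IsPosSemidef ∧ E.support ⊆ K ∧
    ∀ α : Fin n → ℕ, E.Integrable (fun x => ∏ i, x i ^ α i) ∧
      S α = E.integral (fun x => ∏ i, x i ^ α i)

/-- The hypercube `[-1,1]ⁿ`. -/
def hypercube (n : ℕ) : Set (Fin n → ℝ) := {x | ∀ i, x i ∈ Set.Icc (-1 : ℝ) 1}

/-- Position `2i - 1` of a `2n`-tuple, for `i = 1, …, n` (written with indices from `0`). -/
def oddPos {n : ℕ} (i : Fin n) : Fin (2 * n) := ⟨2 * i.val, by have := i.isLt; omega⟩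

/-- Position `2i` of a `2n`-tuple, for `i = 1, …, n` (written with indices from `0`). -/
def evenPos {n : ℕ} (i : Fin n) : Fin (2 * n) := ⟨2 * i.val + 1, by have := i.isLt; omega⟩

/-- `e(β) = β₂ + β₄ + ⋯ + β₂ₙ`. -/
def evenSum {n : ℕ} (β : Fin (2 * n) → ℕ) : ℕ := ∑ i : Fin n, β (evenPos i)

/-- The multi-index `(β₁ + β₂, β₃ + β₄, …, β₂ₙ₋₁ + β₂ₙ)`. -/
def pairSum {n : ℕ} (β : Fin (2 * n) → ℕ) : Fin n → ℕ :=
  fun i => β (oddPos i) + β (evenPos i)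

/-- `binom(α, β) = ∏ₖ binom(αₖ, βₖ)`. -/
def multiChoose {m : ℕ} (α β : Fin m → ℕ) : ℕ := ∏ k, (α k).choose (β k)

end

/-!
The semiring `P` generated by the nonnegative constants and the polynomials `1 ± X i` is
Archimedean, so its states form a compact convex set. An extreme state is multiplicative: if `u` and
`w` lie in `P` and add up to a constant, a state `φ` is a convex combination of the states
proportional to `φ (u * ·)` and `φ (w * ·)`, hence equal to both when it is extreme. The extreme
states are therefore evaluations at points of the cube, and by Krein–Milman every linear functional
that is nonnegative on `P` is integration against a measure on the cube.

A symmetric matrix is positive semidefinite iff its trace against every positive definite matrix is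
nonnegative, and the products `∏ i, (1 + X i) ^ a i * (1 - X i) ^ b i` span `P` over the nonnegative
reals. So the inequalities say that the matrix-valued Riesz functional `L` is positive semidefinite
on `P`. Representing each functional `vᵀ L v` by a measure `μ v` on the cube, polarization assembles
the `μ v` into a matrix of signed measures `τ`; as a signed measure on the cube is determined by its
moments (Stone–Weierstrass), `vᵀ τ v = μ v ≥ 0`.
-/

open MeasureTheory MvPolynomial
open scoped NNReal

section ArchimedeanSemiring

variable {A : Type*} [CommRing A] [Algebra ℝ A] {P : Subalgebra ℝ≥0 A}

/-- A semiring `P` of elements of a real algebra, containing the nonnegative constants, is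
Archimedean if every element of the algebra is dominated by a constant in the ordering
`a ≤ b ↔ b - a ∈ P`. -/
def IsArchimedeanSemiring (P : Subalgebra ℝ≥0 A) : Prop :=
  ∀ a : A, ∃ c : ℝ, algebraMap ℝ A c - a ∈ P

theorem algebraMap_mem_of_nonneg (P : Subalgebra ℝ≥0 A) {c : ℝ} (hc : 0 ≤ c) :
    algebraMap ℝ A c ∈ P :=
  P.algebraMap_mem ⟨c, hc⟩

theorem mul_sub_mul_mem_and_mul_add_mul_mem {a b c d : A} (ha : c - a ∈ P) (ha' : c + a ∈ P)
    (hb : d - b ∈ P) (hb' : d + b ∈ P) : c * d - a * b ∈ P ∧ c * d + a * b ∈ P := by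
  have half_mem : algebraMap ℝ A (1 / 2) ∈ P := algebraMap_mem_of_nonneg P (by norm_num)
  have two_mul_half : 2 * algebraMap ℝ A (1 / 2) = 1 := by
    rw [← map_ofNat (algebraMap ℝ A) 2, ← map_mul]
    norm_num
  have hsub : c * d - a * b =
      algebraMap ℝ A (1 / 2) * ((c - a) * (d + b) + (c + a) * (d - b)) := by
    linear_combination -(c * d - a * b) * two_mul_half
  have hadd : c * d + a * b =
      algebraMap ℝ A (1 / 2) * ((c + a) * (d + b) + (c - a) * (d - b)) := by
    linear_combination -(c * d + a * b) * two_mul_half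
  rw [hsub, hadd]
  exact ⟨mul_mem half_mem (add_mem (mul_mem ha hb') (mul_mem ha' hb)),
    mul_mem half_mem (add_mem (mul_mem ha' hb') (mul_mem ha hb))⟩

theorem isArchimedeanSemiring_of_adjoin_eq_top {s : Set A} (hs : Algebra.adjoin ℝ s = ⊤)
    (hbound : ∀ a ∈ s, ∃ c : ℝ, algebraMap ℝ A c - a ∈ P ∧ algebraMap ℝ A c + a ∈ P) :
    IsArchimedeanSemiring P := by
  suffices h : ∀ a : A, ∃ c : ℝ, algebraMap ℝ A c - a ∈ P ∧ algebraMap ℝ A c + a ∈ P from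
    fun a => (h a).imp fun _ => And.left
  intro a
  have ha : a ∈ Algebra.adjoin ℝ s := hs ▸ Algebra.mem_top
  induction ha using Algebra.adjoin_induction with
  | mem a ha => exact hbound a ha
  | algebraMap r =>
    refine ⟨|r|, ?_, ?_⟩
    · rw [← map_sub]
      exact algebraMap_mem_of_nonneg P (sub_nonneg.2 (le_abs_self r))
    · rw [← map_add]
      exact algebraMap_mem_of_nonneg P (neg_le_iff_add_nonneg.1 (neg_abs_le r |> neg_le.1))
  | add a b _ _ iha ihb =>
    obtain ⟨c, hc, hc'⟩ := iha
    obtain ⟨d, hd, hd'⟩ := ihb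
    refine ⟨c + d, ?_, ?_⟩
    · rw [map_add, add_sub_add_comm]
      exact add_mem hc hd
    · rw [map_add, add_add_add_comm]
      exact add_mem hc' hd'
  | mul a b _ _ iha ihb =>
    obtain ⟨c, hc, hc'⟩ := iha
    obtain ⟨d, hd, hd'⟩ := ihb
    refine ⟨c * d, ?_⟩
    rw [map_mul]
    exact mul_sub_mul_mem_and_mul_add_mul_mem hc hc' hd hd'

theorem map_algebraMap_eq_smul_map_one {E : Type*} [AddCommGroup E] [Module ℝ E]
    (φ : A →ₗ[ℝ] E) (c : ℝ) : φ (algebraMap ℝ A c) = c • φ 1 := by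
  rw [Algebra.algebraMap_eq_smul_one, map_smul]

theorem apply_le_mul_apply_one {φ : A →ₗ[ℝ] ℝ} (hφ : ∀ a ∈ P, 0 ≤ φ a) {a : A} {c : ℝ}
    (ha : algebraMap ℝ A c - a ∈ P) : φ a ≤ c * φ 1 := by
  simpa [map_algebraMap_eq_smul_map_one] using hφ _ ha

theorem eq_zero_of_apply_one_eq_zero (hP : IsArchimedeanSemiring P) {φ : A →ₗ[ℝ] ℝ}
    (hφ : ∀ a ∈ P, 0 ≤ φ a) (h1 : φ 1 = 0) : φ = 0 := by
  have hle : ∀ a, φ a ≤ 0 := fun a => by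
    obtain ⟨c, hc⟩ := hP a
    simpa [h1] using apply_le_mul_apply_one hφ hc
  ext a
  exact le_antisymm (hle a) (by simpa using hle (-a))

/-- The states of `P`: the linear functionals that are nonnegative on `P` and normalized at `1`.
They are taken as bare functions in order to carry the topology of pointwise convergence. -/
def stateSpace (P : Subalgebra ℝ≥0 A) : Set (A → ℝ) :=
  (fun φ : A →ₗ[ℝ] ℝ => ⇑φ) '' {φ | (∀ a ∈ P, 0 ≤ φ a) ∧ φ 1 = 1}

theorem isClosed_stateSpace (P : Subalgebra ℝ≥0 A) : IsClosed (stateSpace P) := by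
  have heq : stateSpace P = Set.range (fun φ : A →ₗ[ℝ] ℝ => ⇑φ) ∩
      ((⋂ a ∈ P, {f | 0 ≤ f a}) ∩ {f | f 1 = 1}) := by
    rw [← Set.image_preimage_eq_range_inter, stateSpace]
    congr! 1
    ext φ
    simp only [Set.mem_ofPred_eq, Set.mem_preimage, Set.mem_inter_iff, Set.mem_iInter]
  rw [heq]
  exact (LinearMap.isClosed_range_coe A ℝ (RingHom.id ℝ)).inter
    ((isClosed_biInter fun a _ => isClosed_le continuous_const (continuous_apply a)).inter
      (isClosed_eq (continuous_apply 1) continuous_const))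

theorem isCompact_stateSpace (hP : IsArchimedeanSemiring P) : IsCompact (stateSpace P) := by
  choose c hc using hP
  refine (isCompact_univ_pi fun a => isCompact_Icc (a := -c (-a)) (b := c a)).of_isClosed_subset
    (isClosed_stateSpace P) ?_
  rintro _ ⟨φ, ⟨hφ, h1⟩, rfl⟩ a -
  have hle : ∀ b, φ b ≤ c b := fun b => by simpa [h1] using apply_le_mul_apply_one hφ (hc b)
  exact ⟨neg_le.1 (map_neg φ a ▸ hle (-a)), hle a⟩

theorem convex_stateSpace (P : Subalgebra ℝ≥0 A) : Convex ℝ (stateSpace P) := by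
  rintro _ ⟨φ, ⟨hφ, hφ1⟩, rfl⟩ _ ⟨ψ, ⟨hψ, hψ1⟩, rfl⟩ r s hr hs hrs
  refine ⟨r • φ + s • ψ, ⟨fun a ha => ?_, ?_⟩, rfl⟩
  · exact add_nonneg (mul_nonneg hr (hφ a ha)) (mul_nonneg hs (hψ a ha))
  · simp [hφ1, hψ1, hrs]

theorem smul_comp_mulLeft_mem_stateSpace {φ : A →ₗ[ℝ] ℝ} (hφ : ∀ a ∈ P, 0 ≤ φ a) {u : A}
    (hu : u ∈ P) (hφu : 0 < φ u) :
    (fun a => (φ u)⁻¹ * φ (u * a)) ∈ stateSpace P := by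
  refine ⟨(φ u)⁻¹ • φ ∘ₗ LinearMap.mulLeft ℝ u, ⟨fun a ha => ?_, ?_⟩, rfl⟩
  · exact mul_nonneg (inv_nonneg.2 hφu.le) (hφ _ (mul_mem hu ha))
  · simp [hφu.ne']

theorem apply_mul_of_mem_extremePoints {φ : A →ₗ[ℝ] ℝ}
    (hφ : ⇑φ ∈ (stateSpace P).extremePoints ℝ) {u w : A} (hu : u ∈ P) (hw : w ∈ P)
    (hφu : 0 < φ u) (hφw : 0 < φ w) {d : ℝ} (huw : u + w = algebraMap ℝ A d) (a : A) :
    φ (u * a) = φ u * φ a := by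
  obtain ⟨⟨ψ, ⟨hpos, h1⟩, hψ⟩, hext⟩ := mem_extremePoints_iff_left.1 hφ
  obtain rfl : ψ = φ := DFunLike.coe_injective hψ
  have hd : ψ u + ψ w = d := by
    rw [← map_add, huw, map_algebraMap_eq_smul_map_one, h1, smul_eq_mul, mul_one]
  have hd_pos : 0 < d := hd ▸ add_pos hφu hφw
  -- `ψ` is the convex combination of the states `a ↦ ψ (u a) / ψ u` and `a ↦ ψ (w a) / ψ w`
  -- with weights `ψ u / d` and `ψ w / d`.
  have hu_eq := hext _ (smul_comp_mulLeft_mem_stateSpace hpos hu hφu)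
    _ (smul_comp_mulLeft_mem_stateSpace hpos hw hφw)
    ⟨ψ u / d, ψ w / d, div_pos hφu hd_pos, div_pos hφw hd_pos,
      by rw [← add_div, hd, div_self hd_pos.ne'], ?_⟩
  · rw [← congrFun hu_eq a, mul_inv_cancel_left₀ hφu.ne']
  · funext b
    have hsum : ψ (u * b) + ψ (w * b) = d * ψ b := by
      rw [← map_add, ← add_mul, huw, ← Algebra.smul_def, map_smul, smul_eq_mul]
    simp only [Pi.add_apply, Pi.smul_apply, smul_eq_mul]
    field_simp
    exact hsum

theorem map_mul_of_mem_extremePoints (hP : IsArchimedeanSemiring P) {φ : A →ₗ[ℝ] ℝ}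
    (hφ : ⇑φ ∈ (stateSpace P).extremePoints ℝ) (a b : A) : φ (a * b) = φ a * φ b := by
  obtain ⟨ψ, ⟨hpos, h1⟩, hψ⟩ := hφ.1
  obtain rfl : ψ = φ := DFunLike.coe_injective hψ
  have shift : ∀ a : A, ∃ c : ℝ, algebraMap ℝ A c + a ∈ P ∧ 0 < ψ (algebraMap ℝ A c + a) := by
    intro a
    obtain ⟨c, hc⟩ := hP (-a)
    rw [sub_neg_eq_add] at hc
    have hadd : algebraMap ℝ A (c + 1) + a = algebraMap ℝ A c + a + 1 := by
      rw [map_add, map_one, add_right_comm]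
    refine ⟨c + 1, hadd ▸ add_mem hc (one_mem P), ?_⟩
    rw [hadd, map_add, h1]
    exact add_pos_of_nonneg_of_pos (hpos _ hc) one_pos
  obtain ⟨c, hu, hψu⟩ := shift a
  obtain ⟨d, hw, hψw⟩ := shift (-a)
  have hmul := apply_mul_of_mem_extremePoints hφ hu hw hψu hψw (d := c + d)
    (by rw [map_add]; ring) b
  rw [add_mul, ← Algebra.smul_def, map_add, map_add, map_algebraMap_eq_smul_map_one, map_smul,
    h1] at hmul
  simp only [smul_eq_mul] at hmul
  linarith

theorem exists_algHom_of_mem_extremePoints (hP : IsArchimedeanSemiring P) {f : A → ℝ}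
    (hf : f ∈ (stateSpace P).extremePoints ℝ) :
    ∃ χ : A →ₐ[ℝ] ℝ, (∀ a ∈ P, 0 ≤ χ a) ∧ ⇑χ = f := by
  obtain ⟨φ, ⟨hφ, h1⟩, rfl⟩ := hf.1
  exact ⟨AlgHom.ofLinearMap φ h1 (map_mul_of_mem_extremePoints hP hf), hφ, rfl⟩

end ArchimedeanSemiring

section IntegralRepresentation

variable {K : Type*} [TopologicalSpace K] [CompactSpace K] [MeasurableSpace K] [BorelSpace K]

theorem integrable_continuousMap (μ : Measure K) [IsFiniteMeasure μ] (f : C(K, ℝ)) :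
    Integrable f μ :=
  f.continuous.integrable_of_hasCompactSupport (HasCompactSupport.of_compactSpace f)

theorem convex_range_integral {J : Type*} (F : J → C(K, ℝ)) :
    Convex ℝ (Set.range fun (μ : ProbabilityMeasure K) (j : J) => ∫ x, F j x ∂(μ : Measure K)) := by
  rintro _ ⟨μ, rfl⟩ _ ⟨ν, rfl⟩ r s hr hs hrs
  let ρ : Measure K := ENNReal.ofReal r • (μ : Measure K) + ENNReal.ofReal s • (ν : Measure K)
  have hρ : IsProbabilityMeasure ρ := ⟨by simp [ρ, ← ENNReal.ofReal_add hr hs, hrs]⟩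
  refine ⟨⟨ρ, hρ⟩, funext fun j => ?_⟩
  change ∫ x, F j x ∂ρ = r * ∫ x, F j x ∂(μ : Measure K) + s * ∫ x, F j x ∂(ν : Measure K)
  rw [integral_add_measure
      ((integrable_continuousMap _ (F j)).smul_measure ENNReal.ofReal_ne_top)
      ((integrable_continuousMap _ (F j)).smul_measure ENNReal.ofReal_ne_top),
    integral_smul_measure, integral_smul_measure, ENNReal.toReal_ofReal hr,
    ENNReal.toReal_ofReal hs, smul_eq_mul, smul_eq_mul]

theorem isClosed_range_integral [T2Space K] {J : Type*} (F : J → C(K, ℝ)) :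
    IsClosed
      (Set.range fun (μ : ProbabilityMeasure K) (j : J) => ∫ x, F j x ∂(μ : Measure K)) :=
  (isCompact_range (continuous_pi fun j =>
    ProbabilityMeasure.continuous_integral_continuousMap (F j))).isClosed

variable {A : Type*} [CommRing A] [Algebra ℝ A] {P : Subalgebra ℝ≥0 A} {ι : A →ₐ[ℝ] C(K, ℝ)}

theorem stateSpace_subset_range_integral [T2Space K] (hP : IsArchimedeanSemiring P)
    (hι : ∀ χ : A →ₐ[ℝ] ℝ, (∀ a ∈ P, 0 ≤ χ a) → ∃ x, ∀ a, χ a = ι a x) :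
    stateSpace P ⊆ Set.range fun (μ : ProbabilityMeasure K) (a : A) =>
      ∫ x, ι a x ∂(μ : Measure K) := by
  rw [← closure_convexHull_extremePoints (isCompact_stateSpace hP) (convex_stateSpace P)]
  refine closure_minimal (convexHull_min ?_ (convex_range_integral ι)) (isClosed_range_integral ι)
  intro f hf
  obtain ⟨χ, hχ, rfl⟩ := exists_algHom_of_mem_extremePoints hP hf
  obtain ⟨x, hx⟩ := hι χ hχ
  refine ⟨⟨Measure.dirac x, inferInstance⟩, funext fun a => ?_⟩
  simp [hx, integral_dirac]

theorem exists_measure_of_nonneg [T2Space K] (hP : IsArchimedeanSemiring P)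
    (hι : ∀ χ : A →ₐ[ℝ] ℝ, (∀ a ∈ P, 0 ≤ χ a) → ∃ x, ∀ a, χ a = ι a x) {φ : A →ₗ[ℝ] ℝ}
    (hφ : ∀ a ∈ P, 0 ≤ φ a) :
    ∃ μ : Measure K, IsFiniteMeasure μ ∧ ∀ a, φ a = ∫ x, ι a x ∂μ := by
  rcases (hφ 1 (one_mem P)).eq_or_lt with h1 | h1
  · exact ⟨0, inferInstance, by simp [eq_zero_of_apply_one_eq_zero hP hφ h1.symm]⟩
  · have hmem : (fun a => (φ 1)⁻¹ * φ a) ∈ stateSpace P := by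
      simpa using smul_comp_mulLeft_mem_stateSpace hφ (one_mem P) h1
    obtain ⟨μ, hμ⟩ := stateSpace_subset_range_integral hP hι hmem
    refine ⟨ENNReal.ofReal (φ 1) • (μ : Measure K),
      Measure.smul_finite _ ENNReal.ofReal_ne_top, fun a => ?_⟩
    have hμa : ∫ x, ι a x ∂(μ : Measure K) = (φ 1)⁻¹ * φ a := congrFun hμ a
    rw [integral_smul_measure, hμa, ENNReal.toReal_ofReal h1.le, smul_eq_mul,
      mul_inv_cancel_left₀ h1.ne']

end IntegralRepresentation

section Uniqueness

variable {K : Type*} [TopologicalSpace K] [CompactSpace K] [MeasurableSpace K] [BorelSpace K]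

theorem measure_ext_of_separatesPoints [PolishSpace K] {B : Subalgebra ℝ C(K, ℝ)}
    (hB : B.SeparatesPoints) {μ ν : Measure K} [IsFiniteMeasure μ] [IsFiniteMeasure ν]
    (h : ∀ f ∈ B, ∫ x, f x ∂μ = ∫ x, f x ∂ν) : μ = ν := by
  let B' : StarSubalgebra ℝ (BoundedContinuousFunction K ℝ) :=
    { B.comap (BoundedContinuousFunction.toContinuousMapₐ ℝ) with star_mem' := id }
  refine ext_of_forall_mem_subalgebra_integral_eq_of_polish (A := B') (fun x y hxy => ?_)
    fun g hg => h _ hg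
  obtain ⟨_, ⟨f, hf, rfl⟩, hfxy⟩ := hB hxy
  exact ⟨f, ⟨f, ⟨BoundedContinuousFunction.mkOfCompact f, hf, rfl⟩, rfl⟩, hfxy⟩

instance isFiniteMeasure_variation {X : Type*} [MeasurableSpace X] (τ : SignedMeasure X) :
    IsFiniteMeasure τ.variation := by
  rw [← SignedMeasure.totalVariation_eq_variation, SignedMeasure.totalVariation]
  infer_instance

theorem signedMeasure_integrable_continuousMap (τ : SignedMeasure K) (f : C(K, ℝ)) :
    τ.Integrable f :=
  integrable_continuousMap τ.variation f

theorem signedMeasure_ext_of_separatesPoints [PolishSpace K] {B : Subalgebra ℝ C(K, ℝ)}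
    (hB : B.SeparatesPoints) {σ τ : SignedMeasure K}
    (h : ∀ f ∈ B, ∫ᵛ x, f x ∂<•σ = ∫ᵛ x, f x ∂<•τ) : σ = τ := by
  rw [← sub_eq_zero]
  set J := (σ - τ).toJordanDecomposition
  have hJ : J.posPart.toSignedMeasure - J.negPart.toSignedMeasure = σ - τ :=
    SignedMeasure.toSignedMeasure_toJordanDecomposition (σ - τ)
  have hparts : J.posPart = J.negPart := measure_ext_of_separatesPoints hB fun f hf => by
    have integrable := fun ρ : SignedMeasure K => signedMeasure_integrable_continuousMap ρ f
    have hzero : ∫ᵛ x, f x ∂<•(σ - τ) = 0 := by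
      rw [VectorMeasure.integral_sub_vectorMeasure (integrable _) (integrable _), h f hf, sub_self]
    rwa [← hJ, VectorMeasure.integral_sub_vectorMeasure (integrable _) (integrable _),
      VectorMeasure.integral_toSignedMeasure, VectorMeasure.integral_toSignedMeasure,
      sub_eq_zero] at hzero
  rw [← hJ, sub_eq_zero]
  ext s
  simp [hparts]

end Uniqueness

section PositiveSignedMeasure

variable {X : Type*} [MeasurableSpace X]

theorem signedMeasure_integral_nonneg {τ : SignedMeasure X} (hτ : 0 ≤ τ) {K : Set X}
    (hK : MeasurableSet K) (hτK : τ Kᶜ = 0) {f : X → ℝ} (hf : ∀ x ∈ K, 0 ≤ f x) :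
    0 ≤ ∫ᵛ x, f x ∂<•τ := by
  have hτ' : 0 ≤[Set.univ] τ := (VectorMeasure.le_restrict_univ_iff_le 0 τ).2 hτ
  rw [← SignedMeasure.toMeasureOfZeroLE_toSignedMeasure τ hτ',
    VectorMeasure.integral_toSignedMeasure]
  have hae : ∀ᵐ x ∂τ.toMeasureOfZeroLE Set.univ MeasurableSet.univ hτ', x ∈ K := by
    rw [ae_iff, ← Set.compl_def, SignedMeasure.toMeasureOfZeroLE_apply _ _ _ hK.compl]
    simp [hτK]
  exact integral_nonneg_of_ae (hae.mono hf)

variable {m : Type*} [Fintype m]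

/-- The signed measure `vᵀ τ v` obtained by applying the quadratic form of a matrix `τ` of signed
measures to a vector `v`. -/
noncomputable def quadraticMeasure (τ : m → m → SignedMeasure X) (v : m → ℝ) : SignedMeasure X :=
  ∑ i, ∑ j, (v i * v j) • τ i j

theorem dotProduct_mulVec_eq_sum (M : Matrix m m ℝ) (v : m → ℝ) :
    v ⬝ᵥ (M *ᵥ v) = ∑ i, ∑ j, v i * v j * M i j := by
  simp only [dotProduct, Matrix.mulVec, Finset.mul_sum]
  exact Finset.sum_congr rfl fun i _ => Finset.sum_congr rfl fun j _ => by ring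

theorem quadraticMeasure_apply (τ : m → m → SignedMeasure X) (v : m → ℝ) (s : Set X) :
    quadraticMeasure τ v s = v ⬝ᵥ (Matrix.of (fun i j => τ i j s) *ᵥ v) := by
  simp [quadraticMeasure, dotProduct_mulVec_eq_sum]

theorem integral_quadraticMeasure {τ : m → m → SignedMeasure X} {f : X → ℝ}
    (hf : ∀ i j, (τ i j).Integrable f) (v : m → ℝ) :
    ∫ᵛ x, f x ∂<•quadraticMeasure τ v =
      v ⬝ᵥ (Matrix.of (fun i j => ∫ᵛ x, f x ∂<•τ i j) *ᵥ v) := by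
  have hint : ∀ i, ∀ j ∈ Finset.univ, ((v i * v j) • τ i j).Integrable f :=
    fun i j _ => (hf i j).smul_vectorMeasure _
  simp only [quadraticMeasure, dotProduct_mulVec_eq_sum, Matrix.of_apply]
  rw [VectorMeasure.integral_finsetSum_vectorMeasure fun i _ =>
    VectorMeasure.Integrable.finsetSum_vectorMeasure (hint i)]
  refine Finset.sum_congr rfl fun i _ => ?_
  rw [VectorMeasure.integral_finsetSum_vectorMeasure (hint i)]
  exact Finset.sum_congr rfl fun j _ => VectorMeasure.integral_smul_vectorMeasure _ _

end PositiveSignedMeasure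

section MatrixValuedRepresentation

variable {m : Type*} {A : Type*} [CommRing A] [Algebra ℝ A] {P : Subalgebra ℝ≥0 A}

theorem isSymm_of_posSemidef_on (hP : IsArchimedeanSemiring P) {L : A →ₗ[ℝ] Matrix m m ℝ}
    (hL : ∀ a ∈ P, (L a).PosSemidef) (a : A) : (L a).IsSymm := by
  have isSymm_of_mem : ∀ b ∈ P, (L b).IsSymm := fun b hb =>
    Matrix.isHermitian_iff_isSymm.1 (hL b hb).isHermitian
  obtain ⟨c, hc⟩ := hP a
  have hLa : L a = c • L 1 - L (algebraMap ℝ A c - a) := by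
    rw [map_sub, map_algebraMap_eq_smul_map_one, sub_sub_cancel]
  rw [hLa]
  exact ((isSymm_of_mem 1 (one_mem P)).smul c).sub (isSymm_of_mem _ hc)

variable [Fintype m]

/-- The scalar functional `a ↦ vᵀ L(a) v` attached to a matrix-valued functional `L`. -/
def quadraticFunctional (L : A →ₗ[ℝ] Matrix m m ℝ) (v : m → ℝ) : A →ₗ[ℝ] ℝ where
  toFun a := v ⬝ᵥ (L a *ᵥ v)
  map_add' a b := by rw [map_add, Matrix.add_mulVec, dotProduct_add]
  map_smul' c a := by rw [map_smul, Matrix.smul_mulVec, dotProduct_smul, RingHom.id_apply]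

theorem quadraticFunctional_nonneg {L : A →ₗ[ℝ] Matrix m m ℝ}
    (hL : ∀ a ∈ P, (L a).PosSemidef) (v : m → ℝ) : ∀ a ∈ P, 0 ≤ quadraticFunctional L v a :=
  fun a ha => (hL a ha).dotProduct_mulVec_nonneg v

theorem polarization_single [DecidableEq m] {M : Matrix m m ℝ} (hM : M.IsSymm) (i j : m) :
    M i j = (1 / 4 : ℝ) * ((Pi.single i 1 + Pi.single j 1) ⬝ᵥ
        (M *ᵥ (Pi.single i 1 + Pi.single j 1)) -
      (Pi.single i 1 - Pi.single j 1) ⬝ᵥ (M *ᵥ (Pi.single i 1 - Pi.single j 1))) := by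
  have hij := hM.apply i j
  simp only [Matrix.mulVec_add, Matrix.mulVec_sub, dotProduct_add, dotProduct_sub, add_dotProduct,
    sub_dotProduct, single_dotProduct, Matrix.mulVec_single_one, Matrix.col_apply, one_mul]
  linarith

variable {K : Type*} [TopologicalSpace K] [CompactSpace K] [PolishSpace K] [MeasurableSpace K]
  [BorelSpace K] {ι : A →ₐ[ℝ] C(K, ℝ)}

theorem exists_signedMeasure_of_posSemidef (hP : IsArchimedeanSemiring P)
    (hι : ∀ χ : A →ₐ[ℝ] ℝ, (∀ a ∈ P, 0 ≤ χ a) → ∃ x, ∀ a, χ a = ι a x)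
    (hsep : ι.range.SeparatesPoints) {L : A →ₗ[ℝ] Matrix m m ℝ}
    (hL : ∀ a ∈ P, (L a).PosSemidef) :
    ∃ τ : m → m → SignedMeasure K, (∀ i j, τ i j = τ j i) ∧ (∀ v, 0 ≤ quadraticMeasure τ v) ∧
      ∀ a i j, L a i j = ∫ᵛ x, ι a x ∂<•τ i j := by
  classical
  have hsymm := isSymm_of_posSemidef_on hP hL
  choose μ hμfin hμ using fun v =>
    exists_measure_of_nonneg hP hι (quadraticFunctional_nonneg hL v)
  have integrable := fun (ρ : SignedMeasure K) a => signedMeasure_integrable_continuousMap ρ (ι a)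
  have unique {σ τ : SignedMeasure K} (h : ∀ a, ∫ᵛ x, ι a x ∂<•σ = ∫ᵛ x, ι a x ∂<•τ) : σ = τ :=
    signedMeasure_ext_of_separatesPoints hsep (by rintro _ ⟨a, rfl⟩; exact h a)
  let τ : m → m → SignedMeasure K := fun i j =>
    (1 / 4 : ℝ) • ((μ (Pi.single i 1 + Pi.single j 1)).toSignedMeasure -
      (μ (Pi.single i 1 - Pi.single j 1)).toSignedMeasure)
  have hτ : ∀ a i j, L a i j = ∫ᵛ x, ι a x ∂<•τ i j := fun a i j => by
    rw [VectorMeasure.integral_smul_vectorMeasure,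
      VectorMeasure.integral_sub_vectorMeasure (integrable _ a) (integrable _ a),
      VectorMeasure.integral_toSignedMeasure, VectorMeasure.integral_toSignedMeasure,
      ← hμ, ← hμ]
    exact polarization_single (hsymm a) i j
  have hquad : ∀ v, quadraticMeasure τ v = (μ v).toSignedMeasure := fun v => unique fun a => by
    rw [integral_quadraticMeasure fun i j => integrable _ a, VectorMeasure.integral_toSignedMeasure,
      ← hμ]
    simp only [← hτ]
    rfl
  refine ⟨τ, fun i j => unique fun a => ?_, fun v => ?_, hτ⟩
  · rw [← hτ, ← hτ, (hsymm a).apply]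
  · rw [hquad]
    exact Measure.zero_le_toSignedMeasure _

end MatrixValuedRepresentation

section TraceDuality

variable {m 𝕜 : Type*} [Fintype m] [RCLike 𝕜]

open scoped ComplexOrder

theorem trace_mul_nonneg_of_posSemidef {G M : Matrix m m 𝕜} (hG : G.PosSemidef)
    (hM : M.PosSemidef) : 0 ≤ (G * M).trace := by
  obtain ⟨k, B, rfl⟩ := Matrix.posSemidef_iff_eq_sum_vecMulVec.1 hG
  rw [Finset.sum_mul, Matrix.trace_sum]
  refine Finset.sum_nonneg fun l _ => ?_
  rw [Matrix.vecMulVec_mul, Matrix.trace_vecMulVec, dotProduct_comm, ← Matrix.dotProduct_mulVec]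
  exact hM.dotProduct_mulVec_nonneg (B l)

theorem posSemidef_iff_forall_posDef_trace_mul_nonneg {M : Matrix m m 𝕜} (hM : M.IsHermitian) :
    M.PosSemidef ↔ ∀ G : Matrix m m 𝕜, G.PosDef → 0 ≤ (G * M).trace := by
  classical
  refine ⟨fun h G hG => trace_mul_nonneg_of_posSemidef hG.posSemidef h, fun h =>
    Matrix.PosSemidef.of_dotProduct_mulVec_nonneg hM fun v => ?_⟩
  have hperturbed : ∀ ε : ℝ, 0 < ε → 0 ≤ star v ⬝ᵥ (M *ᵥ v) + (ε : 𝕜) * M.trace := fun ε hε => by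
    have hG : (Matrix.vecMulVec v (star v) + (ε : 𝕜) • (1 : Matrix m m 𝕜)).PosDef :=
      Matrix.PosDef.posSemidef_add (Matrix.posSemidef_vecMulVec_self_star v)
        (Matrix.PosDef.one.smul (RCLike.ofReal_pos.2 hε))
    have htrace := h _ hG
    rwa [add_mul, smul_mul_assoc, one_mul, Matrix.trace_add, Matrix.trace_smul, smul_eq_mul,
      Matrix.vecMulVec_mul, Matrix.trace_vecMulVec, dotProduct_comm,
      ← Matrix.dotProduct_mulVec] at htrace
  have hlim : Filter.Tendsto (fun ε : ℝ => star v ⬝ᵥ (M *ᵥ v) + (ε : 𝕜) * M.trace)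
      (nhdsWithin 0 (Set.Ioi 0)) (nhds (star v ⬝ᵥ (M *ᵥ v))) :=
    tendsto_nhdsWithin_of_tendsto_nhds (Continuous.tendsto' (by fun_prop) _ _ (by simp))
  exact ge_of_tendsto hlim (Filter.eventually_of_mem self_mem_nhdsWithin hperturbed)

end TraceDuality

section MomentFunctional

variable {R E σ : Type*} [CommSemiring R] [AddCommMonoid E] [Module R E]

/-- The Riesz functional of the family `s`: the linear map on polynomials that sends each monomial
`X ^ γ` to `s γ`. -/
noncomputable def momentFunctional (s : (σ → ℕ) → E) : MvPolynomial σ R →ₗ[R] E :=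
  (basisMonomials σ R).constr R fun γ => s γ

theorem momentFunctional_monomial (s : (σ → ℕ) → E) (γ : σ →₀ ℕ) (a : R) :
    momentFunctional s (monomial γ a) = a • s γ := by
  have hγ : momentFunctional s (basisMonomials σ R γ) = s γ :=
    (basisMonomials σ R).constr_basis R _ γ
  rw [← hγ, ← map_smul, coe_basisMonomials, smul_monomial, smul_eq_mul, mul_one]

theorem momentFunctional_prod_X_pow [Fintype σ] (s : (σ → ℕ) → E) (γ : σ → ℕ) :
    momentFunctional s (∏ i, X i ^ γ i : MvPolynomial σ R) = s γ := by
  have hγ : (∏ i, X i ^ γ i : MvPolynomial σ R) =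
      monomial (Finsupp.equivFunOnFinite.symm γ) 1 := by
    rw [monomial_eq, C_1, one_mul, Finsupp.prod_fintype _ _ fun _ => pow_zero _]
    rfl
  rw [hγ, momentFunctional_monomial, one_smul, Finsupp.coe_equivFunOnFinite_symm]

end MomentFunctional

namespace MatrixMeasure

variable {n t : ℕ} {E : MatrixMeasure n t}

theorem integrable_eval (hE : ∀ γ : Fin n → ℕ, E.Integrable fun x => ∏ i, x i ^ γ i)
    (p : MvPolynomial (Fin n) ℝ) : E.Integrable fun x => eval x p := by
  intro i j
  induction p using MvPolynomial.induction_on' with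
  | monomial γ a =>
    simp only [eval_monomial, Finsupp.prod_fintype _ _ fun _ => pow_zero _]
    exact (hE γ i j).const_mul a
  | add p q hp hq =>
    simp only [map_add]
    exact hp.add hq

theorem integral_eval (hE : ∀ γ : Fin n → ℕ, E.Integrable fun x => ∏ i, x i ^ γ i)
    (p : MvPolynomial (Fin n) ℝ) :
    E.integral (fun x => eval x p) =
      momentFunctional (fun γ => E.integral fun x => ∏ i, x i ^ γ i) p := by
  induction p using MvPolynomial.induction_on' with
  | monomial γ a =>
    ext i j
    simp only [momentFunctional_monomial, integral, eval_monomial,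
      Finsupp.prod_fintype _ _ fun _ => pow_zero _]
    exact VectorMeasure.integral_fun_smul (E i j) _ a fun x => ∏ k, x k ^ γ k
  | add p q hp hq =>
    rw [map_add, ← hp, ← hq]
    ext i j
    simp only [integral, map_add]
    exact VectorMeasure.integral_fun_add (integrable_eval hE p i j) (integrable_eval hE q i j)

theorem isClosed_support (E : MatrixMeasure n t) : IsClosed E.support :=
  isClosed_iUnion_of_finite fun _ => isClosed_iUnion_of_finite fun _ => Measure.isClosed_support

theorem apply_compl_support (E : MatrixMeasure n t) (i j : Fin t) : E i j E.supportᶜ = 0 := by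
  have hvariation : (E i j).variation E.supportᶜ = 0 :=
    measure_mono_null (Set.compl_subset_compl.2 <|
      Set.subset_iUnion₂ (s := fun i j => (E i j).variation.support) i j)
      Measure.measure_compl_support
  have hle := VectorMeasure.enorm_measure_le_variation (E i j) E.supportᶜ
  simpa [hvariation] using hle

theorem IsPosSemidef.quadraticMeasure_nonneg (hE : E.IsPosSemidef) (v : Fin t → ℝ) :
    0 ≤ quadraticMeasure E v :=
  VectorMeasure.le_iff.2 fun s hs => by
    rw [quadraticMeasure_apply]
    exact hE.2 s hs v

theorem IsPosSemidef.posSemidef_integral (hE : E.IsPosSemidef) {f : (Fin n → ℝ) → ℝ}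
    (hf : E.Integrable f) (hf_nonneg : ∀ x ∈ E.support, 0 ≤ f x) : (E.integral f).PosSemidef := by
  have hsymm : (E.integral f).IsHermitian := by
    ext i j
    simp [integral, hE.1 j i]
  refine Matrix.PosSemidef.of_dotProduct_mulVec_nonneg hsymm fun v => ?_
  rw [star_trivial, integral, ← integral_quadraticMeasure hf]
  refine signedMeasure_integral_nonneg (hE.quadraticMeasure_nonneg v)
    E.isClosed_support.measurableSet ?_ hf_nonneg
  simp [quadraticMeasure, apply_compl_support]

end MatrixMeasure

theorem IsMatrixMomentSequence.posSemidef_momentFunctional {n t : ℕ} {K : Set (Fin n → ℝ)}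
    {S : (Fin n → ℕ) → Matrix (Fin t) (Fin t) ℝ} (h : IsMatrixMomentSequence K S)
    {p : MvPolynomial (Fin n) ℝ} (hp : ∀ x ∈ K, 0 ≤ eval x p) :
    (momentFunctional S p).PosSemidef := by
  obtain ⟨E, hE, hsupport, hmoments⟩ := h
  have hint := fun γ => (hmoments γ).1
  obtain rfl : S = fun γ => E.integral fun x => ∏ i, x i ^ γ i := funext fun γ => (hmoments γ).2
  rw [← MatrixMeasure.integral_eval hint]
  exact hE.posSemidef_integral (MatrixMeasure.integrable_eval hint p)
    fun x hx => hp x (hsupport hx)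

theorem support_variation_map_subtype_val {X : Type*} [TopologicalSpace X] [MeasurableSpace X]
    [BorelSpace X] {K : Set X} (hK : IsClosed K) (τ : SignedMeasure K) :
    (τ.map Subtype.val).variation.support ⊆ K := by
  have hemb := MeasurableEmbedding.subtype_coe hK.measurableSet
  refine Measure.support_subset_of_isClosed hK ?_
  rw [mem_ae_iff, hemb.variation_map, hemb.map_apply, Set.preimage_compl,
    Subtype.coe_preimage_self, Set.compl_univ, measure_empty]

theorem isMatrixMomentSequence_of_signedMeasure {n t : ℕ} {K : Set (Fin n → ℝ)} (hK : IsClosed K)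
    {S : (Fin n → ℕ) → Matrix (Fin t) (Fin t) ℝ} {τ : Fin t → Fin t → SignedMeasure K}
    (hsymm : ∀ i j, τ i j = τ j i) (hpos : ∀ v, 0 ≤ quadraticMeasure τ v)
    (hint : ∀ (γ : Fin n → ℕ) i j, (τ i j).Integrable fun x => ∏ k, x.1 k ^ γ k)
    (hS : ∀ γ i j, S γ i j = ∫ᵛ x, ∏ k, x.1 k ^ γ k ∂<•τ i j) : IsMatrixMomentSequence K S := by
  have hemb := MeasurableEmbedding.subtype_coe hK.measurableSet
  refine ⟨fun i j => (τ i j).map Subtype.val,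
    ⟨fun i j => congrArg (·.map Subtype.val) (hsymm i j), fun s hs v => ?_⟩, ?_,
    fun γ => ⟨fun i j => hemb.integrable_map_vectorMeasure.2 (hint γ i j), ?_⟩⟩
  · simp only [MatrixMeasure.value, VectorMeasure.map_apply _ hemb.measurable hs]
    rw [← quadraticMeasure_apply]
    exact VectorMeasure.le_iff.1 (hpos v) _ (hemb.measurable hs)
  · exact Set.iUnion₂_subset fun i j => support_variation_map_subtype_val hK (τ i j)
  · ext i j
    rw [hS, MatrixMeasure.integral, Matrix.of_apply, hemb.integral_map_vectorMeasure]

section NonnegSet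

variable {σ : Type*} {P : Subalgebra ℝ≥0 (MvPolynomial σ ℝ)}

/-- The set of points at which all polynomials in `P` are nonnegative. -/
def nonnegSet (P : Subalgebra ℝ≥0 (MvPolynomial σ ℝ)) : Set (σ → ℝ) :=
  {x | ∀ p ∈ P, 0 ≤ eval x p}

theorem mem_nonnegSet_adjoin {s : Set (MvPolynomial σ ℝ)} {x : σ → ℝ} :
    x ∈ nonnegSet (Algebra.adjoin ℝ≥0 s) ↔ ∀ p ∈ s, 0 ≤ eval x p := by
  refine ⟨fun hx p hp => hx p (Algebra.subset_adjoin hp), fun hx p hp => ?_⟩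
  induction hp using Algebra.adjoin_induction with
  | mem p hp => exact hx p hp
  | algebraMap c => exact (eval_C (c : ℝ)).symm ▸ c.2
  | add p q _ _ hp hq => exact (map_add (eval x) p q).symm ▸ add_nonneg hp hq
  | mul p q _ _ hp hq => exact (map_mul (eval x) p q).symm ▸ mul_nonneg hp hq

theorem isClosed_nonnegSet (P : Subalgebra ℝ≥0 (MvPolynomial σ ℝ)) : IsClosed (nonnegSet P) := by
  simp only [nonnegSet, Set.ofPred_forall]
  exact isClosed_biInter fun p _ => isClosed_le continuous_const p.continuous_eval

theorem isCompact_nonnegSet (hP : IsArchimedeanSemiring P) : IsCompact (nonnegSet P) := by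
  choose c hc using hP
  refine (isCompact_univ_pi fun i => isCompact_Icc (a := -c (-X i)) (b := c (X i)))
    |>.of_isClosed_subset (isClosed_nonnegSet P) fun x hx i _ => ?_
  have hle : ∀ p, eval x p ≤ c p := fun p => by simpa [algebraMap_eq] using hx _ (hc p)
  exact ⟨neg_le.1 (by simpa using hle (-X i)), by simpa using hle (X i)⟩

/-- Restriction of polynomial functions to `K`, as a map into the continuous functions on `K`. -/
noncomputable def polynomialRestriction (K : Set (σ → ℝ)) : MvPolynomial σ ℝ →ₐ[ℝ] C(K, ℝ) where
  toFun p := ⟨fun x => eval x.1 p, p.continuous_eval.comp continuous_subtype_val⟩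
  map_one' := by ext; simp
  map_mul' p q := by ext; simp
  map_zero' := by ext; simp
  map_add' p q := by ext; simp
  commutes' c := by ext; simp

theorem separatesPoints_range_polynomialRestriction (K : Set (σ → ℝ)) :
    (polynomialRestriction K).range.SeparatesPoints := by
  intro x y hxy
  obtain ⟨i, hi⟩ := Function.ne_iff.1 (Subtype.coe_ne_coe.2 hxy)
  exact ⟨_, ⟨_, ⟨X i, rfl⟩, rfl⟩, by simpa [polynomialRestriction] using hi⟩

theorem exists_mem_nonnegSet_of_algHom {χ : MvPolynomial σ ℝ →ₐ[ℝ] ℝ} (hχ : ∀ p ∈ P, 0 ≤ χ p) :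
    ∃ x : nonnegSet P, ∀ p, χ p = polynomialRestriction (nonnegSet P) p x := by
  have hχ_eval : ∀ p, χ p = eval (χ ∘ X) p := fun p => by
    rw [← coe_aeval_eq_eval]
    exact DFunLike.congr_fun (aeval_unique χ) p
  exact ⟨⟨χ ∘ X, fun p hp => hχ_eval p ▸ hχ p hp⟩, hχ_eval⟩

theorem isMatrixMomentSequence_nonnegSet_iff {n t : ℕ}
    {P : Subalgebra ℝ≥0 (MvPolynomial (Fin n) ℝ)} (hP : IsArchimedeanSemiring P)
    {S : (Fin n → ℕ) → Matrix (Fin t) (Fin t) ℝ} :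
    IsMatrixMomentSequence (nonnegSet P) S ↔ ∀ p ∈ P, (momentFunctional S p).PosSemidef := by
  refine ⟨fun h p hp => h.posSemidef_momentFunctional fun x hx => hx p hp, fun h => ?_⟩
  have := isCompact_iff_compactSpace.1 (isCompact_nonnegSet hP)
  have := (isClosed_nonnegSet P).polishSpace
  obtain ⟨τ, hsymm, hpos, hτ⟩ := exists_signedMeasure_of_posSemidef hP
    (fun _ hχ => exists_mem_nonnegSet_of_algHom hχ)
    (separatesPoints_range_polynomialRestriction (nonnegSet P)) h
  have hmonomial : ∀ γ : Fin n → ℕ, (fun x : nonnegSet P => ∏ k, x.1 k ^ γ k) =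
      polynomialRestriction (nonnegSet P) (∏ k, X k ^ γ k) := fun γ => by
    ext x
    simp [polynomialRestriction]
  refine isMatrixMomentSequence_of_signedMeasure (isClosed_nonnegSet P) hsymm hpos
    (fun γ i j => ?_) fun γ i j => ?_
  · rw [hmonomial]
    exact signedMeasure_integrable_continuousMap _ _
  · rw [hmonomial, ← hτ, momentFunctional_prod_X_pow]

end NonnegSet

section Hypercube

theorem prod_one_add_pow {R : Type*} [CommSemiring R] {m : ℕ} (f : Fin m → R) (α : Fin m → ℕ) :
    ∏ k, (1 + f k) ^ α k = ∑ β ∈ Finset.Iic α, (multiChoose α β : R) * ∏ k, f k ^ β k := by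
  have hIic : Finset.Iic α = Fintype.piFinset fun k => Finset.range (α k + 1) := by
    ext β
    simp [Pi.le_def]
  simp only [add_comm (1 : R), add_pow, one_pow, mul_one, Finset.prod_univ_sum, ← hIic,
    Finset.prod_mul_distrib, multiChoose, Nat.cast_prod]
  exact Finset.sum_congr rfl fun β _ => mul_comm _ _

theorem adjoin_range_eq_span_prod_pow {R A ι : Type*} [CommSemiring R] [CommSemiring A]
    [Algebra R A] [Fintype ι] (f : ι → A) :
    Subalgebra.toSubmodule (Algebra.adjoin R (Set.range f)) =
      Submodule.span R (Set.range fun α : ι → ℕ => ∏ k, f k ^ α k) := by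
  rw [Algebra.adjoin_eq_span]
  congr 1
  ext a
  simp only [SetLike.mem_coe, Submonoid.mem_closure_range_iff_of_fintype, Set.mem_range, eq_comm]

variable {n t : ℕ}

theorem bijective_elim_oddPos_evenPos :
    Function.Bijective (Sum.elim oddPos evenPos : Fin n ⊕ Fin n → Fin (2 * n)) := by
  constructor
  · rintro (i | i) (j | j) h <;>
      simp only [Sum.elim_inl, Sum.elim_inr, oddPos, evenPos, Fin.mk.injEq] at h
    exacts [congrArg _ (Fin.ext (by omega)), by omega, by omega, congrArg _ (Fin.ext (by omega))]
  · intro k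
    rcases Nat.even_or_odd' k.val with ⟨i, hi | hi⟩
    · exact ⟨.inl ⟨i, by omega⟩, Fin.ext hi.symm⟩
    · exact ⟨.inr ⟨i, by omega⟩, Fin.ext hi.symm⟩

theorem forall_iff_forall_oddPos_evenPos {p : Fin (2 * n) → Prop} :
    (∀ k, p k) ↔ ∀ i, p (oddPos i) ∧ p (evenPos i) := by
  rw [bijective_elim_oddPos_evenPos.surjective.forall, Sum.forall, forall_and]
  rfl

theorem prod_oddPos_mul_evenPos {M : Type*} [CommMonoid M] (f : Fin (2 * n) → M) :
    ∏ k, f k = ∏ i, f (oddPos i) * f (evenPos i) := by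
  rw [← bijective_elim_oddPos_evenPos.prod_comp, Fintype.prod_sum_type, Finset.prod_mul_distrib]
  rfl

/-- The variable `X i` at the `i`-th odd position and `-X i` at the `i`-th even position, so that
the facets of the cube are the zero sets of the `2n` polynomials `1 + signedVar k`. -/
noncomputable def signedVar (k : Fin (2 * n)) : MvPolynomial (Fin n) ℝ :=
  Sum.elim X (-X) ((Equiv.ofBijective _ bijective_elim_oddPos_evenPos).symm k)

theorem signedVar_oddPos (i : Fin n) : signedVar (oddPos i) = X i :=
  congrArg (Sum.elim X (-X))
    (Equiv.ofBijective_symm_apply_apply _ bijective_elim_oddPos_evenPos (.inl i))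

theorem signedVar_evenPos (i : Fin n) : signedVar (evenPos i) = -X i :=
  congrArg (Sum.elim X (-X))
    (Equiv.ofBijective_symm_apply_apply _ bijective_elim_oddPos_evenPos (.inr i))

theorem prod_signedVar_pow (β : Fin (2 * n) → ℕ) :
    ∏ k, signedVar k ^ β k = (-1) ^ evenSum β * ∏ i, X i ^ pairSum β i := by
  have hpair : ∀ i, signedVar (oddPos i) ^ β (oddPos i) * signedVar (evenPos i) ^ β (evenPos i) =
      (-1) ^ β (evenPos i) * X i ^ pairSum β i := fun i => by
    rw [signedVar_oddPos, signedVar_evenPos, neg_pow, pairSum, pow_add]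
    ring
  rw [prod_oddPos_mul_evenPos, Finset.prod_congr rfl fun i _ => hpair i, Finset.prod_mul_distrib,
    Finset.prod_pow_eq_pow_sum, evenSum]

/-- The polynomial `∏ i, (1 + X i) ^ α (oddPos i) * (1 - X i) ^ α (evenPos i)`. -/
noncomputable def facetProduct (α : Fin (2 * n) → ℕ) : MvPolynomial (Fin n) ℝ :=
  ∏ k, (1 + signedVar k) ^ α k

theorem facetProduct_eq_sum (α : Fin (2 * n) → ℕ) :
    facetProduct α = ∑ β ∈ Finset.Iic α,
      ((-1 : ℝ) ^ evenSum β * (multiChoose α β : ℝ)) • ∏ i, X i ^ pairSum β i := by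
  rw [facetProduct, prod_one_add_pow]
  refine Finset.sum_congr rfl fun β _ => ?_
  rw [prod_signedVar_pow, smul_eq_C_mul, map_mul, map_pow, map_neg, map_one, map_natCast]
  ring

theorem momentFunctional_facetProduct {E : Type*} [AddCommGroup E] [Module ℝ E]
    (s : (Fin n → ℕ) → E) (α : Fin (2 * n) → ℕ) :
    momentFunctional s (facetProduct α) = ∑ β ∈ Finset.Iic α,
      ((-1 : ℝ) ^ evenSum β * (multiChoose α β : ℝ)) • s (pairSum β) := by
  simp only [facetProduct_eq_sum, map_sum, map_smul, momentFunctional_prod_X_pow]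

/-- The semiring generated by the nonnegative constants and the polynomials `1 + X i` and
`1 - X i`. -/
noncomputable def cubeSemiring (n : ℕ) : Subalgebra ℝ≥0 (MvPolynomial (Fin n) ℝ) :=
  Algebra.adjoin ℝ≥0 (Set.range fun k => 1 + signedVar k)

theorem isArchimedeanSemiring_cubeSemiring (n : ℕ) : IsArchimedeanSemiring (cubeSemiring n) := by
  have mem (k : Fin (2 * n)) : 1 + signedVar k ∈ cubeSemiring n :=
    Algebra.subset_adjoin ⟨k, rfl⟩
  refine isArchimedeanSemiring_of_adjoin_eq_top (adjoin_range_X (R := ℝ) (σ := Fin n)) ?_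
  rintro _ ⟨i, rfl⟩
  refine ⟨1, ?_, ?_⟩
  · simpa [signedVar_evenPos, sub_eq_add_neg] using mem (evenPos i)
  · simpa [signedVar_oddPos] using mem (oddPos i)

theorem nonnegSet_cubeSemiring (n : ℕ) : nonnegSet (cubeSemiring n) = hypercube n := by
  ext x
  rw [cubeSemiring, mem_nonnegSet_adjoin, Set.forall_mem_range, forall_iff_forall_oddPos_evenPos]
  refine forall_congr' fun i => and_congr ?_ ?_
  · simp [signedVar_oddPos, neg_le_iff_add_nonneg']
  · simp [signedVar_evenPos, ← sub_eq_add_neg]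

theorem forall_mem_cubeSemiring_posSemidef_iff
    {L : MvPolynomial (Fin n) ℝ →ₗ[ℝ] Matrix (Fin t) (Fin t) ℝ} :
    (∀ p ∈ cubeSemiring n, (L p).PosSemidef) ↔ ∀ α, (L (facetProduct α)).PosSemidef := by
  have mem_iff (p) : p ∈ cubeSemiring n ↔ p ∈ Submodule.span ℝ≥0 (Set.range facetProduct) := by
    rw [← Subalgebra.mem_toSubmodule, cubeSemiring, adjoin_range_eq_span_prod_pow]
    rfl
  simp only [mem_iff]
  refine ⟨fun h α => h _ (Submodule.subset_span ⟨α, rfl⟩), fun h p hp => ?_⟩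
  induction hp using Submodule.span_induction with
  | mem p hp =>
    obtain ⟨α, rfl⟩ := hp
    exact h α
  | zero => exact (map_zero L).symm ▸ Matrix.PosSemidef.zero
  | add p q _ _ hp hq => exact (map_add L p q).symm ▸ hp.add hq
  | smul c p _ hp => exact (map_smul L (c : ℝ) p).symm ▸ hp.smul c.2

end Hypercube

theorem mainTheorem2 (n t : ℕ) (S : (Fin n → ℕ) → Matrix (Fin t) (Fin t) ℝ)
    (hS : ∀ α, (S α).IsSymm) :
    IsMatrixMomentSequence (hypercube n) S ↔
      ∀ G : Matrix (Fin t) (Fin t) ℝ, G.PosDef → ∀ α : Fin (2 * n) → ℕ,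
        0 ≤ ∑ β ∈ Finset.Iic α,
          (-1 : ℝ) ^ evenSum β * (multiChoose α β : ℝ) * (G * S (pairSum β)).trace := by
  have hsymm (α : Fin (2 * n) → ℕ) : (momentFunctional S (facetProduct α)).IsHermitian := by
    rw [momentFunctional_facetProduct]
    exact isSelfAdjoint_sum _ fun β _ => Matrix.isHermitian_iff_isSymm.2 ((hS _).smul _)
  have htrace (G : Matrix (Fin t) (Fin t) ℝ) (α : Fin (2 * n) → ℕ) :
      (G * momentFunctional S (facetProduct α)).trace = ∑ β ∈ Finset.Iic α,
        (-1 : ℝ) ^ evenSum β * (multiChoose α β : ℝ) * (G * S (pairSum β)).trace := by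
    simp only [momentFunctional_facetProduct, Finset.mul_sum, Matrix.trace_sum, mul_smul_comm,
      Matrix.trace_smul, smul_eq_mul]
  rw [← nonnegSet_cubeSemiring,
    isMatrixMomentSequence_nonnegSet_iff (isArchimedeanSemiring_cubeSemiring n),
    forall_mem_cubeSemiring_posSemidef_iff]
  simp only [posSemidef_iff_forall_posDef_trace_mul_nonneg (hsymm _), htrace]
  exact ⟨fun h G hG α => h α G hG, fun h α G hG => h G hG α⟩
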